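/- Let $(\Omega,\mathcal F,P)$ be a probability space and let $L^0=L^0(\mathcal F,\mathbb R)$ be the algebra of $P$-a.s. equivalence classes of real random variables, ordered by a.s. inequality. Events and inclusions of events are understood modulo $P$-null sets, $I_D$ denotes the class of the indicator function of an event $D$, $[\xi>0]$ denotes the event on which $\xi\in L^0$ is positive, and $\bigwedge$ denotes the infimum in $L^0$. Let $(S,\|\cdot\|)$ be a real random normed module with base $(\Omega,\mathcal F,P)$: $S$ is a module over $L^0$ (hence a real vector space) and $\|\cdot\|:S\to L^0_+=\{\xi\in L^0:\xi\ge 0\}$ satisfies $\|\xi x\|=|\xi|\,\|x\|$ for $\xi\in L^0$, $\|x+y\|\le\|x\|+\|y\|$, and $\|x\|=0\Rightarrow x=0$. Assume that $S$ is complete for the $(\epsilon,\lambda)$-topology, in which the sets $\{x\in S: P(\|x\|<\epsilon)>1-\lambda\}$ $(\epsilon>0,\ 0<\lambda<1)$ form a base of neighbourhoods of $0$. For $x,y\in S$ put $A_x=[\|x\|>0]$ and $B_{xy}=A_x\cap A_y\cap A_{x-y}$. Let $H(S)$ be the support of $S$, i.e. the smallest event containing all $A_x$, $x\in S$. Say that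 $S$ has quasi-rank at least $2$ on an event $D\subset H(S)$ with $P(D)>0$ if there are $x,y\in S$ such that, for all $\xi,\eta\in L^0$, $\xi I_Dx+\eta I_Dy=0$ implies $\xi I_D=\eta I_D=0$. Let $G(S)$ be the maximal event on which $S$ has quasi-rank at least $2$, i.e. the smallest event containing all $D\subset H(S)$ with $P(D)>0$ on which $S$ has quasi-rank at least $2$. Assume $P(G(S))>0$. Put $S(1)=\{x\in S:\|x\|=I_A\text{ for some event }A\text{ with }P(A)>0\}$ and $U(1)=\{x\in S:\|x\|\le 1\}$. For an event $D\subset G(S)$ with $P(D)>0$ and $\epsilon\in L^0_+$ with $0<\epsilon\le 2$ a.s. on $D$, define $$\delta_D(\epsilon)=\bigwedge\left\{I_D-I_D\left\|\tfrac{x+y}{2}\right\|:x,y\in S(1),\ B_{xy}\supset D,\ I_D\|x-y\|\ge\epsilon I_D\right\},$$ $$\delta^{(1)}_D(\epsilon)=\bigwedge\left\{I_D-I_D\left\|\tfrac{x+y}{2}\right\|:x,y\in S(1),\ B_{xy}\supset D,\ I_D\|x-y\|=\epsilon I_D\right\},$$ $$\delta^{(2)}_D(\epsilon)=\bigwedge\left\{I_D-I_D\left\|\tfrac{x+y}{2}\right\|:x,y\in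 U(1),\ B_{xy}\supset D,\ I_D\|x-y\|\ge\epsilon I_D\right\}.$$ Then, for all such $D$ and $\epsilon$, the three infima exist in $L^0$ and $$\delta_D(\epsilon)=\delta^{(1)}_D(\epsilon)=\delta^{(2)}_D(\epsilon).$$ -/

import Mathlib

open MeasureTheory

namespace RandomConvexity

/-- The measurable sets of `Ω`. An element of `F̃` (a measurable set modulo `P`-null sets) is
handled through a representative; inclusion is always taken modulo `P`-null sets, see `Incl`. -/
abbrev Event (Ω : Type*) [MeasurableSpace Ω] : Type _ := {D : Set Ω // MeasurableSet D}

section Basic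

variable {Ω : Type*} [MeasurableSpace Ω] (P : Measure Ω)

/-- `D ⊂ E` in `F̃`, that is, `P (D \ E) = 0`. -/
def Incl (D E : Event Ω) : Prop := P ((D : Set Ω) \ (E : Set Ω)) = 0

/-- The ring structure of `L⁰(F, ℝ)`, with Mathlib's operations. -/
noncomputable instance instCommRingL0 : CommRing (Ω →ₘ[P] ℝ) :=
  { (inferInstance : AddCommGroup (Ω →ₘ[P] ℝ)), (inferInstance : CommMonoid (Ω →ₘ[P] ℝ)) with
    left_distrib := fun a b c => AEEqFun.toGerm_injective <| by
      simp only [AEEqFun.mul_toGerm, AEEqFun.add_toGerm, mul_add]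
    right_distrib := fun a b c => AEEqFun.toGerm_injective <| by
      simp only [AEEqFun.mul_toGerm, AEEqFun.add_toGerm, add_mul]
    zero_mul := fun a => AEEqFun.toGerm_injective <| by
      simp only [AEEqFun.mul_toGerm, AEEqFun.zero_toGerm, zero_mul]
    mul_zero := fun a => AEEqFun.toGerm_injective <| by
      simp only [AEEqFun.mul_toGerm, AEEqFun.zero_toGerm, mul_zero] }

/-- The class `I_D` of the characteristic function of `D`, an element of `L⁰(F, ℝ)`. -/
noncomputable def ind (D : Event Ω) : Ω →ₘ[P] ℝ :=
  AEEqFun.mk ((D : Set Ω).indicator fun _ => (1 : ℝ))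
    (stronglyMeasurable_const.indicator D.2).aestronglyMeasurable

variable {P} in
/-- The event `[ξ > 0]`. -/
def pos (ξ : Ω →ₘ[P] ℝ) : Event Ω :=
  ⟨{ω | 0 < ξ ω}, measurableSet_lt measurable_const ξ.stronglyMeasurable.measurable⟩

/-- `G` is the union in `F̃` of the family `C`: its least upper bound modulo `P`-null sets.
Equivalently, `I_G` is the supremum of the functions `I_D`, `D ∈ C`. -/
def IsEssUnion (C : Set (Event Ω)) (G : Event Ω) : Prop :=
  (∀ D ∈ C, Incl P D G) ∧ ∀ B : Event Ω, (∀ D ∈ C, Incl P D B) → Incl P G B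

theorem exists_isEssUnion [IsFiniteMeasure P] (C : Set (Event Ω)) :
    ∃ G : Event Ω, IsEssUnion P C G := by
  let T : Set ENNReal :=
    {r | ∃ s : Set (Event Ω), s ⊆ C ∧ s.Countable ∧ r = P (⋃ D ∈ s, (D : Set Ω))}
  have hT : T.Nonempty := ⟨_, ∅, Set.empty_subset _, Set.countable_empty, rfl⟩
  obtain ⟨u, -, hu, huT⟩ := exists_seq_tendsto_sSup hT (OrderTop.bddAbove T)
  choose s hsC hsc hsu using huT
  let t : Set (Event Ω) := ⋃ n, s n
  have htC : t ⊆ C := Set.iUnion_subset hsC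
  have htc : t.Countable := Set.countable_iUnion hsc
  let G : Event Ω := ⟨⋃ D ∈ t, (D : Set Ω), MeasurableSet.biUnion htc fun D _ => D.2⟩
  have hG : sSup T ≤ P (G : Set Ω) := by
    refine le_of_tendsto' hu fun n => ?_
    rw [hsu n]
    exact measure_mono (Set.biUnion_subset_biUnion_left (Set.subset_iUnion s n))
  refine ⟨G, fun D hD => ?_, fun B hB => ?_⟩
  · have h1 : P ((D : Set Ω) ∪ (G : Set Ω)) ≤ P (G : Set Ω) := by
      refine le_trans (le_sSup ?_) hG
      refine ⟨insert D t, Set.insert_subset hD htC, htc.insert D, ?_⟩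
      rw [Set.biUnion_insert]
    have h2 : P ((D : Set Ω) \ (G : Set Ω)) + P (G : Set Ω) ≤ 0 + P (G : Set Ω) := by
      rw [← measure_union Set.disjoint_sdiff_left G.2, Set.sdiff_union_self, zero_add]
      exact h1
    exact le_antisymm ((ENNReal.add_le_add_iff_right (measure_ne_top P _)).1 h2) bot_le
  · unfold Incl
    have : (G : Set Ω) \ (B : Set Ω) = ⋃ D ∈ t, ((D : Set Ω) \ (B : Set Ω)) := by
      simp only [G, Set.iUnion_sdiff]
    rw [this, measure_biUnion_null_iff htc]
    exact fun D hD => hB D (htC hD)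

/-- The union in `F̃` of a family of events (unique modulo `P`-null sets). -/
noncomputable def essUnion [IsFiniteMeasure P] (C : Set (Event Ω)) : Event Ω :=
  (exists_isEssUnion P C).choose

open Classical in
variable {P} in
/-- The infimum `⋀ A` in the ordered set `L⁰(F, ℝ)` (with the default `0` if there is none). -/
noncomputable def bigwedge (A : Set (Ω →ₘ[P] ℝ)) : Ω →ₘ[P] ℝ :=
  if h : ∃ g, IsGLB A g then h.choose else 0

end Basic

/-- An `L⁰`-norm on a module `S` over the algebra `L⁰(F, ℝ)`; with it, `S` is a real random normed
module with base `(Ω, F, P)`. Homogeneity over `ℝ` is the case of constant `ξ`. -/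
structure L0Norm {Ω : Type*} [MeasurableSpace Ω] (P : Measure Ω)
    (S : Type*) [AddCommGroup S] [Module (Ω →ₘ[P] ℝ) S] where
  toFun : S → (Ω →ₘ[P] ℝ)
  nonneg' : ∀ x, 0 ≤ toFun x
  smul' : ∀ (ξ : Ω →ₘ[P] ℝ) (x : S), toFun (ξ • x) = |ξ| * toFun x
  add_le' : ∀ x y, toFun (x + y) ≤ toFun x + toFun y
  eq_zero' : ∀ x, toFun x = 0 → x = 0

namespace L0Norm

variable {Ω : Type*} [MeasurableSpace Ω] {P : Measure Ω}
  {S : Type*} [AddCommGroup S] [Module (Ω →ₘ[P] ℝ) S]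

instance : CoeFun (L0Norm P S) (fun _ => S → (Ω →ₘ[P] ℝ)) := ⟨L0Norm.toFun⟩

variable (N : L0Norm P S)

/-- The basic neighbourhood `N(ε, l)` of `0` in the `(ε, λ)`-topology of `S`. -/
def nhd (ε l : ℝ) : Set S := {x | 1 - l < P.real {ω | N x ω < ε}}

/-- Completeness for the `(ε, λ)`-topology. This topology is metrizable and linear, so that
completeness is the convergence of Cauchy sequences. -/
def IsComplete : Prop :=
  ∀ x : ℕ → S,
    (∀ ε l : ℝ, 0 < ε → 0 < l → l < 1 → ∃ n₀, ∀ m ≥ n₀, ∀ n ≥ n₀, x m - x n ∈ N.nhd ε l) →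
    ∃ z : S, ∀ ε l : ℝ, 0 < ε → 0 < l → l < 1 → ∃ n₀, ∀ n ≥ n₀, x n - z ∈ N.nhd ε l

/-- `A_x = [‖x‖ > 0]`. -/
def A (x : S) : Event Ω := pos (N x)

/-- `B_{xy} = A_x ∩ A_y ∩ A_{x-y}`. -/
def B (x y : S) : Event Ω := N.A x ⊓ N.A y ⊓ N.A (x - y)

/-- The support `H(S)`, i.e. the event on which the supremum of all `‖x‖` is positive: the union
in `F̃` of the events `[‖x‖ > 0]`. -/
noncomputable def H [IsFiniteMeasure P] : Event Ω := essUnion P (Set.range N.A)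

variable (P) in
/-- `x` and `y` are `L⁰`-independent on `F`. -/
def Indep (F : Event Ω) (x y : S) : Prop :=
  ∀ ξ η : Ω →ₘ[P] ℝ, (ξ * ind P F) • x + (η * ind P F) • y = 0 →
    ξ * ind P F = 0 ∧ η * ind P F = 0

variable (P S) in
/-- `S` has quasi-rank not less than 2 on `D` (for `D ⊂ H(S)` with `P(D) > 0`). -/
def RankGeTwo (D : Event Ω) : Prop := ∃ x y : S, Indep P D x y

/-- `G(S)`, the largest event (modulo null sets) on which `S` has quasi-rank not less than 2: the
union in `F̃` of all `D ⊂ H(S)` with `P(D) > 0` on which the quasi-rank is not less than 2. -/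
noncomputable def G [IsFiniteMeasure P] : Event Ω :=
  essUnion P {D | Incl P D N.H ∧ 0 < P (D : Set Ω) ∧ RankGeTwo P S D}

/-- The random unit sphere `S(1)`. -/
def sphere : Set S := {x | ∃ E : Event Ω, 0 < P (E : Set Ω) ∧ N x = ind P E}

/-- The random unit ball `U(1)`. -/
def ball : Set S := {x | N x ≤ 1}

section Modulus

variable [Module ℝ S] (D : Event Ω) (ε : Ω →ₘ[P] ℝ)

/-- The set whose infimum is `δ_D(ε)`. -/
def deltaSet : Set (Ω →ₘ[P] ℝ) :=
  {ζ | ∃ x ∈ N.sphere, ∃ y ∈ N.sphere, Incl P D (N.B x y) ∧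
    ε * ind P D ≤ ind P D * N (x - y) ∧ ζ = ind P D - ind P D * N ((2⁻¹ : ℝ) • (x + y))}

/-- The set whose infimum is `δ_D^{(1)}(ε)`. -/
def deltaSet₁ : Set (Ω →ₘ[P] ℝ) :=
  {ζ | ∃ x ∈ N.sphere, ∃ y ∈ N.sphere, Incl P D (N.B x y) ∧
    ind P D * N (x - y) = ε * ind P D ∧ ζ = ind P D - ind P D * N ((2⁻¹ : ℝ) • (x + y))}

/-- The set whose infimum is `δ_D^{(2)}(ε)`. -/
def deltaSet₂ : Set (Ω →ₘ[P] ℝ) :=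
  {ζ | ∃ x ∈ N.ball, ∃ y ∈ N.ball, Incl P D (N.B x y) ∧
    ε * ind P D ≤ ind P D * N (x - y) ∧ ζ = ind P D - ind P D * N ((2⁻¹ : ℝ) • (x + y))}

/-- The modulus of random convexity `δ_D(ε)`. -/
noncomputable def delta : Ω →ₘ[P] ℝ := bigwedge (N.deltaSet D ε)

/-- `δ_D^{(1)}(ε)`. -/
noncomputable def delta₁ : Ω →ₘ[P] ℝ := bigwedge (N.deltaSet₁ D ε)

/-- `δ_D^{(2)}(ε)`. -/
noncomputable def delta₂ : Ω →ₘ[P] ℝ := bigwedge (N.deltaSet₂ D ε)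

end Modulus

end L0Norm

end RandomConvexity

/-!
Every pair in the unit ball whose distance is at least `ε` on `D` can be replaced by a pair on the
unit sphere whose distance is exactly `ε` on `D` and whose sum is at least as long. Hence the
smallest of the three families, `deltaSet₁`, is coinitial in the largest, `deltaSet₂`; the three
families have the same lower bounds, and the infimum exists because they are nonempty and bounded
below by `0`.

The geometry behind the replacement is that of a normed plane. Shrink the segment from `y` to `x`
about its midpoint to the length `ε`, and let `d` be the new difference vector. If `ε = 2`, then `x`
and `y` were unit vectors at distance `2` already. If `ε < 2`, then in a plane containing `d` and
`x + y` a continuity argument yields a unit vector `u` with `‖u - d‖ = 1`, and a form of the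
monotonicity lemma for normed planes (`L0Norm.norm_le_of_combination`) shows that among all segments
in the unit ball with difference vector `d` the one from `u - d` to `u` has the longest sum of
endpoints. The difference vector is never rotated.

All of this is carried out with coefficients in `L⁰`. The continuity argument is a random
intermediate value theorem (`exists_random_zero`), whose zero is an infimum in `L⁰`
(`exists_isGLB`). A plane containing `d` and `x + y` at almost every point of `D` is produced by
`L0Norm.exists_complement`: where `x + y` is a multiple of `d`, a second direction comes from a pair
that is independent on all of `D`. Such a pair exists by exhaustion of `G(S)` and, thanks to
completeness, concatenation along countably many disjoint events
(`L0Norm.IsComplete.exists_indep`).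
-/

namespace RandomConvexity

/-! ### The ordered ring `L⁰` -/

section Scalars

variable {Ω : Type*} [MeasurableSpace Ω] {P : Measure Ω}

theorem ind_ae (D : Event Ω) :
    ∀ᵐ ω ∂P, (ω ∈ (D : Set Ω) → ind P D ω = 1) ∧ (ω ∉ (D : Set Ω) → ind P D ω = 0) := by
  have h : ind P D =ᵐ[P] (D : Set Ω).indicator fun _ => (1 : ℝ) := AEEqFun.coeFn_mk _ _
  filter_upwards [h] with ω h
  rw [h]
  exact ⟨fun hω => by simp [hω], fun hω => by simp [hω]⟩

theorem measurable_coe (ξ : Ω →ₘ[P] ℝ) : Measurable ξ := ξ.stronglyMeasurable.measurable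

theorem exists_ae_eq {f : Ω → ℝ} (hf : Measurable f) : ∃ ξ : Ω →ₘ[P] ℝ, ∀ᵐ ω ∂P, ξ ω = f ω :=
  ⟨AEEqFun.mk f hf.aestronglyMeasurable, AEEqFun.coeFn_mk _ _⟩

theorem coe_add (ξ η : Ω →ₘ[P] ℝ) : ∀ᵐ ω ∂P, (ξ + η) ω = ξ ω + η ω := AEEqFun.coeFn_add ξ η

theorem coe_sub (ξ η : Ω →ₘ[P] ℝ) : ∀ᵐ ω ∂P, (ξ - η) ω = ξ ω - η ω := AEEqFun.coeFn_sub ξ η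

theorem coe_neg (ξ : Ω →ₘ[P] ℝ) : ∀ᵐ ω ∂P, (-ξ) ω = -ξ ω := AEEqFun.coeFn_neg ξ

theorem coe_mul (ξ η : Ω →ₘ[P] ℝ) : ∀ᵐ ω ∂P, (ξ * η) ω = ξ ω * η ω := AEEqFun.coeFn_mul ξ η

theorem coe_one : ∀ᵐ ω ∂P, (1 : Ω →ₘ[P] ℝ) ω = 1 := AEEqFun.coeFn_one

theorem coe_zero : ∀ᵐ ω ∂P, (0 : Ω →ₘ[P] ℝ) ω = 0 := AEEqFun.coeFn_zero

theorem coe_abs (ξ : Ω →ₘ[P] ℝ) : ∀ᵐ ω ∂P, |ξ| ω = |ξ ω| := AEEqFun.coeFn_abs ξ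

theorem coe_two : ∀ᵐ ω ∂P, (2 : Ω →ₘ[P] ℝ) ω = 2 := by
  rw [← one_add_one_eq_two]
  filter_upwards [coe_add (1 : Ω →ₘ[P] ℝ) 1, coe_one (P := P)] with ω h1 h2
  rw [h1, h2]
  norm_num

theorem le_iff_ae {ξ η : Ω →ₘ[P] ℝ} : ξ ≤ η ↔ ∀ᵐ ω ∂P, ξ ω ≤ η ω := AEEqFun.coeFn_le.symm

theorem incl_iff_ae {D E : Event Ω} :
    Incl P D E ↔ ∀ᵐ ω ∂P, ω ∈ (D : Set Ω) → ω ∈ (E : Set Ω) := by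
  rw [Incl, ← compl_mem_ae_iff]
  refine Filter.eventually_congr (Filter.Eventually.of_forall fun ω => ?_)
  change ¬ (_ ∧ ¬ _) ↔ _
  tauto

theorem ind_mul_self (D : Event Ω) : ind P D * ind P D = ind P D := by
  refine AEEqFun.ext ?_
  filter_upwards [coe_mul (ind P D) (ind P D), ind_ae (P := P) D] with ω h1 h2
  by_cases hω : ω ∈ (D : Set Ω)
  · rw [h1, h2.1 hω, one_mul]
  · rw [h1, h2.2 hω, zero_mul]

theorem ind_mul_eq_zero {D E : Event Ω} (h : ∀ ω ∈ (D : Set Ω), ω ∉ (E : Set Ω)) :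
    ind P D * ind P E = 0 := by
  refine AEEqFun.ext ?_
  filter_upwards [coe_mul (ind P D) (ind P E), ind_ae (P := P) D, ind_ae (P := P) E,
    coe_zero (P := P)] with ω h1 h2 h3 h4
  by_cases hω : ω ∈ (D : Set Ω)
  · rw [h1, h4, h3.2 (h ω hω), mul_zero]
  · rw [h1, h4, h2.2 hω, zero_mul]

/-- The infimum of a bounded below family `A` in `L⁰` is, at `ω`, the infimum of the rationals `q`
such that `ω` lies in the essential union of the events `[ζ < q]`, `ζ ∈ A`. -/
theorem exists_isGLB [IsFiniteMeasure P] {A : Set (Ω →ₘ[P] ℝ)} (hne : A.Nonempty)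
    (hbdd : BddBelow A) : ∃ g, IsGLB A g := by
  classical
  obtain ⟨ζ₀, hζ₀⟩ := hne
  obtain ⟨b₀, hb₀⟩ := hbdd
  let lt : (Ω →ₘ[P] ℝ) → ℚ → Event Ω := fun ζ q =>
    ⟨{ω | ζ ω < q}, measurableSet_lt (measurable_coe ζ) measurable_const⟩
  choose G hG using fun q : ℚ => exists_isEssUnion P ((fun ζ => lt ζ q) '' A)
  have hAG : ∀ ζ ∈ A, ∀ᵐ ω ∂P, ∀ q : ℚ, ζ ω < q → ω ∈ (G q : Set Ω) := fun ζ hζ =>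
    ae_all_iff.2 fun q => incl_iff_ae.1 ((hG q).1 _ ⟨ζ, hζ, rfl⟩)
  have hbG : ∀ b ∈ lowerBounds A, ∀ᵐ ω ∂P, ∀ q : ℚ, ω ∈ (G q : Set Ω) → b ω < q := by
    intro b hb
    refine ae_all_iff.2 fun q => incl_iff_ae.1 ((hG q).2 (lt b q) ?_)
    rintro _ ⟨ζ, hζ, rfl⟩
    refine incl_iff_ae.2 ?_
    filter_upwards [le_iff_ae.1 (hb hζ)] with ω h1 h2
    exact lt_of_le_of_lt h1 h2
  let f : Ω → EReal := fun ω => ⨅ q : ℚ, if ω ∈ (G q : Set Ω) then ((q : ℝ) : EReal) else ⊤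
  have hf : Measurable f :=
    Measurable.iInf fun q => Measurable.ite (G q).2 measurable_const measurable_const
  have hf_le : ∀ ζ ∈ A, ∀ᵐ ω ∂P, f ω ≤ (ζ ω : EReal) := by
    intro ζ hζ
    filter_upwards [hAG ζ hζ] with ω h
    refine le_of_forall_gt fun c hc => ?_
    obtain ⟨q, hq1, hq2⟩ := EReal.exists_rat_btwn_of_lt hc
    refine lt_of_le_of_lt (iInf_le _ q) ?_
    rw [if_pos (h q (by exact_mod_cast hq1))]
    exact hq2
  have hle_f : ∀ b ∈ lowerBounds A, ∀ᵐ ω ∂P, (b ω : EReal) ≤ f ω := by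
    intro b hb
    filter_upwards [hbG b hb] with ω h
    refine le_iInf fun q => ?_
    split_ifs with hq
    · exact_mod_cast (h q hq).le
    · exact le_top
  obtain ⟨g, hg⟩ := exists_ae_eq (P := P) (measurable_ereal_toReal.comp hf)
  have hgf : ∀ᵐ ω ∂P, (g ω : EReal) = f ω := by
    filter_upwards [hg, hf_le ζ₀ hζ₀, hle_f b₀ hb₀] with ω h1 h2 h3
    rw [h1]
    exact EReal.coe_toReal (ne_top_of_le_ne_top (EReal.coe_ne_top _) h2)
      (ne_bot_of_le_ne_bot (EReal.coe_ne_bot _) h3)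
  refine ⟨g, fun ζ hζ => le_iff_ae.2 ?_, fun b hb => le_iff_ae.2 ?_⟩
  · filter_upwards [hgf, hf_le ζ hζ] with ω h1 h2
    rw [← h1] at h2
    exact_mod_cast h2
  · filter_upwards [hgf, hle_f b hb] with ω h1 h2
    rw [← h1] at h2
    exact_mod_cast h2

theorem isGLB_bigwedge {A : Set (Ω →ₘ[P] ℝ)} (h : ∃ g, IsGLB A g) : IsGLB A (bigwedge A) := by
  rw [bigwedge, dif_pos h]
  exact h.choose_spec

/-- A random intermediate value theorem: a function `h` on `L⁰` that is Lipschitz with a random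
constant acts locally, and a sign change over `[-1, 1]` produces a random zero. The zero is the
infimum in `L⁰` of the `t ∈ [-1, 1]` with `h t ≥ 0`. -/
theorem exists_random_zero [IsFiniteMeasure P] (D : Event Ω) (h : (Ω →ₘ[P] ℝ) → (Ω →ₘ[P] ℝ))
    (C : Ω →ₘ[P] ℝ) (hC : ∀ s t, ∀ᵐ ω ∂P, |h s ω - h t ω| ≤ C ω * |s ω - t ω|)
    (hlo : ∀ᵐ ω ∂P, ω ∈ (D : Set Ω) → h (-1) ω ≤ 0)
    (hhi : ∀ᵐ ω ∂P, ω ∈ (D : Set Ω) → 0 ≤ h 1 ω) :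
    ∃ s : Ω →ₘ[P] ℝ, (∀ᵐ ω ∂P, -1 ≤ s ω ∧ s ω ≤ 1) ∧ ∀ᵐ ω ∂P, ω ∈ (D : Set Ω) → h s ω = 0 := by
  have coe_neg_one : ∀ᵐ ω ∂P, (-1 : Ω →ₘ[P] ℝ) ω = -1 := by
    filter_upwards [coe_neg (1 : Ω →ₘ[P] ℝ), coe_one (P := P)] with ω h1 h2
    rw [h1, h2]
  let T : Set (Ω →ₘ[P] ℝ) := {t | (∀ᵐ ω ∂P, -1 ≤ t ω ∧ t ω ≤ 1) ∧
    ∀ᵐ ω ∂P, ω ∈ (D : Set Ω) → 0 ≤ h t ω}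
  have h1T : (1 : Ω →ₘ[P] ℝ) ∈ T := by
    refine ⟨?_, hhi⟩
    filter_upwards [coe_one (P := P)] with ω h1
    rw [h1]
    norm_num
  have hlb : (-1 : Ω →ₘ[P] ℝ) ∈ lowerBounds T := fun t ht => le_iff_ae.2 <| by
    filter_upwards [ht.1, coe_neg_one] with ω h1 h2
    rw [h2]
    exact h1.1
  obtain ⟨s, hs⟩ := exists_isGLB ⟨_, h1T⟩ ⟨_, hlb⟩
  have hs1 : ∀ᵐ ω ∂P, -1 ≤ s ω ∧ s ω ≤ 1 := by
    filter_upwards [le_iff_ae.1 (hs.2 hlb), le_iff_ae.1 (hs.1 h1T), coe_neg_one, coe_one (P := P)]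
      with ω h1 h2 h3 h4
    rw [h3] at h1
    rw [h4] at h2
    exact ⟨h1, h2⟩
  -- Where `h s < 0`, the number `s - h s / C` still bounds `T` from below.
  have hge : ∀ᵐ ω ∂P, ω ∈ (D : Set Ω) → 0 ≤ h s ω := by
    obtain ⟨r, hr⟩ := exists_ae_eq (P := P) (f := fun ω => s ω +
      (D : Set Ω).indicator (fun ω => max (-h s ω) 0 / max (C ω) 1) ω) <|
      (measurable_coe s).add <| Measurable.indicator (((measurable_coe (h s)).neg.max
        measurable_const).div ((measurable_coe C).max measurable_const)) D.2
    have hrT : r ∈ lowerBounds T := fun t ht => le_iff_ae.2 <| by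
      filter_upwards [hr, hC t s, ht.2, le_iff_ae.1 (hs.1 ht)] with ω h1 h2 h3 h4
      rw [h1]
      by_cases hω : ω ∈ (D : Set Ω)
      · rw [Set.indicator_of_mem hω]
        have h5 : 0 < max (C ω) 1 := lt_of_lt_of_le one_pos (le_max_right _ _)
        have h6 : max (-h s ω) 0 / max (C ω) 1 ≤ t ω - s ω := by
          rw [div_le_iff₀ h5]
          refine max_le ?_ (mul_nonneg (sub_nonneg.2 h4) h5.le)
          have h7 := h3 hω
          have h8 := le_abs_self (h t ω - h s ω)
          have h9 : C ω * |t ω - s ω| ≤ (t ω - s ω) * max (C ω) 1 := by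
            rw [abs_of_nonneg (sub_nonneg.2 h4), mul_comm]
            exact mul_le_mul_of_nonneg_left (le_max_left _ _) (sub_nonneg.2 h4)
          linarith
        linarith
      · rw [Set.indicator_of_notMem hω, add_zero]
        exact h4
    filter_upwards [hr, le_iff_ae.1 (hs.2 hrT)] with ω h1 h2 hω
    rw [h1, Set.indicator_of_mem hω] at h2
    have h5 : 0 < max (C ω) 1 := lt_of_lt_of_le one_pos (le_max_right _ _)
    have h6 : max (-h s ω) 0 / max (C ω) 1 ≤ 0 := by linarith
    rw [div_le_iff₀ h5, zero_mul] at h6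
    linarith [le_max_left (-h s ω) 0]
  refine ⟨s, hs1, ?_⟩
  -- Where `h s > 0` and `s > -1`, a slightly smaller number than `s` still belongs to `T`.
  obtain ⟨t, ht⟩ := exists_ae_eq (P := P) (f := fun ω => s ω -
    min (max (h s ω) 0 / max (C ω) 1) (s ω + 1)) <|
    (measurable_coe s).sub <| (((measurable_coe (h s)).max measurable_const).div
      ((measurable_coe C).max measurable_const)).min ((measurable_coe s).add_const 1)
  have htT : t ∈ T := by
    constructor
    · filter_upwards [ht, hs1] with ω h1 h2
      have h5 : 0 < max (C ω) 1 := lt_of_lt_of_le one_pos (le_max_right _ _)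
      have h6 : 0 ≤ max (h s ω) 0 / max (C ω) 1 := div_nonneg (le_max_right _ _) h5.le
      have h7 : 0 ≤ min (max (h s ω) 0 / max (C ω) 1) (s ω + 1) := le_min h6 (by linarith)
      have h8 := min_le_right (max (h s ω) 0 / max (C ω) 1) (s ω + 1)
      rw [h1]
      constructor <;> linarith
    · filter_upwards [ht, hs1, hge, hC s t] with ω h1 h2 h3 h4 hω
      have h5 : 0 < max (C ω) 1 := lt_of_lt_of_le one_pos (le_max_right _ _)
      have h6 : 0 ≤ max (h s ω) 0 / max (C ω) 1 := div_nonneg (le_max_right _ _) h5.le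
      have h7 : 0 ≤ min (max (h s ω) 0 / max (C ω) 1) (s ω + 1) := le_min h6 (by linarith)
      have h8 := min_le_left (max (h s ω) 0 / max (C ω) 1) (s ω + 1)
      rw [max_eq_left (h3 hω)] at h8 h7 h1
      rw [le_div_iff₀ h5] at h8
      have h9 : s ω - t ω = min (h s ω / max (C ω) 1) (s ω + 1) := by rw [h1]; ring
      rw [← h9] at h8 h7
      rw [abs_of_nonneg h7] at h4
      have h10 : C ω * (s ω - t ω) ≤ (s ω - t ω) * max (C ω) 1 := by
        rw [mul_comm]
        exact mul_le_mul_of_nonneg_left (le_max_left _ _) h7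
      have h11 := le_abs_self (h s ω - h t ω)
      linarith
  filter_upwards [ht, le_iff_ae.1 (hs.1 htT), hs1, hge, hlo, hC s (-1), coe_neg_one]
    with ω h1 h2 h3 h4 h6 h7 h8 hω
  refine le_antisymm ?_ (h4 hω)
  have h5 : 0 < max (C ω) 1 := lt_of_lt_of_le one_pos (le_max_right _ _)
  have h9 : min (max (h s ω) 0 / max (C ω) 1) (s ω + 1) ≤ 0 := by linarith
  rcases min_le_iff.1 h9 with h10 | h10
  · rw [div_le_iff₀ h5, zero_mul] at h10
    exact (le_max_left _ _).trans h10
  · have h11 : s ω = -1 := by linarith [h3.1]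
    rw [h8, h11, sub_self, abs_zero, mul_zero] at h7
    linarith [h6 hω, le_abs_self (h s ω - h (-1) ω)]

/-- The principle of exhaustion: a property of events that passes to smaller events and to
countable unions of pairwise disjoint events holds on a largest event. -/
theorem exists_maximal_event [IsFiniteMeasure P] (Q : Event Ω → Prop) (h_empty : Q ⊥)
    (h_mono : ∀ D E : Event Ω, (D : Set Ω) ⊆ E → Q E → Q D)
    (h_union : ∀ (D : ℕ → Event Ω) (E : Event Ω), (∀ n, Q (D n)) →
      Pairwise (fun m n => Disjoint (D m : Set Ω) (D n)) → (E : Set Ω) = ⋃ n, (D n : Set Ω) → Q E) :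
    ∃ E, Q E ∧ ∀ D, Q D → Incl P D E := by
  have h_union' : ∀ (D : ℕ → Event Ω) (E : Event Ω), (∀ n, Q (D n)) →
      (E : Set Ω) = ⋃ n, (D n : Set Ω) → Q E := by
    intro D E hD hE
    refine h_union (fun n => ⟨disjointed (fun n => (D n : Set Ω)) n,
      MeasurableSet.disjointed (fun n => (D n).2) n⟩) E (fun n => ?_) ?_ ?_
    · exact h_mono _ _ (disjointed_subset (fun n => (D n : Set Ω)) n) (hD n)
    · exact disjoint_disjointed _
    · rw [hE]
      exact iUnion_disjointed.symm
  let T : Set ENNReal := {r | ∃ E, Q E ∧ r = P (E : Set Ω)}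
  have hT : T.Nonempty := ⟨_, ⊥, h_empty, rfl⟩
  obtain ⟨u, -, hu, huT⟩ := exists_seq_tendsto_sSup hT (OrderTop.bddAbove T)
  choose D hD hDu using huT
  let E : Event Ω := ⟨⋃ n, (D n : Set Ω), MeasurableSet.iUnion fun n => (D n).2⟩
  have hE : Q E := h_union' D E hD rfl
  have hTE : sSup T ≤ P (E : Set Ω) := by
    refine le_of_tendsto' hu fun n => ?_
    rw [hDu n]
    exact measure_mono (Set.subset_iUnion (fun n => (D n : Set Ω)) n)
  refine ⟨E, hE, fun F hF => ?_⟩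
  have hEF : Q (F ⊔ E) := by
    refine h_union' (fun n => if n = 0 then F else E) _ (fun n => ?_) ?_
    · by_cases hn : n = 0
      · simpa [hn] using hF
      · simpa [hn] using hE
    · ext ω
      rw [Set.mem_iUnion]
      constructor
      · rintro (h | h)
        · exact ⟨0, by simpa using h⟩
        · exact ⟨1, by simpa using h⟩
      · rintro ⟨n, hn⟩
        by_cases h0 : n = 0
        · rw [if_pos h0] at hn
          exact Or.inl hn
        · rw [if_neg h0] at hn
          exact Or.inr hn
  have h1 : P ((F : Set Ω) ∪ (E : Set Ω)) ≤ P (E : Set Ω) := 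
    (le_sSup (show P ((F : Set Ω) ∪ (E : Set Ω)) ∈ T from ⟨_, hEF, rfl⟩)).trans hTE
  have h2 : P ((F : Set Ω) \ (E : Set Ω)) + P (E : Set Ω) ≤ 0 + P (E : Set Ω) := by
    rw [← measure_union Set.disjoint_sdiff_left E.2, Set.sdiff_union_self, zero_add]
    exact h1
  exact le_antisymm ((ENNReal.add_le_add_iff_right (measure_ne_top P _)).1 h2) bot_le

end Scalars

namespace L0Norm

variable {Ω : Type*} [MeasurableSpace Ω] {P : Measure Ω}
  {S : Type*} [AddCommGroup S] [Module (Ω →ₘ[P] ℝ) S] (N : L0Norm P S)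

/-! ### Pointwise properties of the random norm -/

theorem nonneg_ae (x : S) : ∀ᵐ ω ∂P, 0 ≤ N x ω := by
  filter_upwards [le_iff_ae.1 (N.nonneg' x), coe_zero (P := P)] with ω h1 h2
  rw [h2] at h1
  exact h1

theorem smul_ae (ξ : Ω →ₘ[P] ℝ) (x : S) : ∀ᵐ ω ∂P, N (ξ • x) ω = |ξ ω| * N x ω := by
  rw [N.smul']
  filter_upwards [coe_mul |ξ| (N x), coe_abs ξ] with ω h1 h2
  rw [h1, h2]

theorem add_ae (x y : S) : ∀ᵐ ω ∂P, N (x + y) ω ≤ N x ω + N y ω := by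
  filter_upwards [le_iff_ae.1 (N.add_le' x y), coe_add (N x) (N y)] with ω h1 h2
  rw [h2] at h1
  exact h1

theorem neg_eq (x : S) : N (-x) = N x := by
  have h := N.smul' (-1) x
  rwa [neg_one_smul, abs_neg, show |(1 : Ω →ₘ[P] ℝ)| = 1 from ?_, one_mul] at h
  refine AEEqFun.ext ?_
  filter_upwards [coe_abs (1 : Ω →ₘ[P] ℝ), coe_one (P := P)] with ω h1 h2
  rw [h1, h2, abs_one]

theorem sub_comm_eq (x y : S) : N (x - y) = N (y - x) := by
  rw [← N.neg_eq, neg_sub]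

theorem sub_ae (x y : S) : ∀ᵐ ω ∂P, N (x - y) ω ≤ N x ω + N y ω := by
  rw [sub_eq_add_neg, ← N.neg_eq y]
  exact N.add_ae x (-y)

theorem abs_sub_ae (x y : S) : ∀ᵐ ω ∂P, |N x ω - N y ω| ≤ N (x - y) ω := by
  have h1 := N.add_ae (x - y) y
  have h2 := N.add_ae (y - x) x
  rw [sub_add_cancel] at h1 h2
  rw [N.sub_comm_eq y x] at h2
  filter_upwards [h1, h2] with ω h1 h2
  rw [abs_le]
  constructor <;> linarith

theorem abs_sub_smul_ae (x y : S) (ξ η : Ω →ₘ[P] ℝ) :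
    ∀ᵐ ω ∂P, |N (x - ξ • y) ω - N (x - η • y) ω| ≤ |ξ ω - η ω| * N y ω := by
  have h := N.abs_sub_ae (x - ξ • y) (x - η • y)
  rw [show x - ξ • y - (x - η • y) = (η - ξ) • y by module] at h
  filter_upwards [h, N.smul_ae (η - ξ) y, coe_sub η ξ] with ω h1 h2 h3
  rwa [h2, h3, abs_sub_comm (η ω)] at h1

/-- The random norm is local: vectors that agree on an event have the same norm there. -/
theorem congr_ae {ξ : Ω →ₘ[P] ℝ} {x y : S} (h : ξ • x = ξ • y) :
    ∀ᵐ ω ∂P, ξ ω ≠ 0 → N x ω = N y ω := by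
  have hx := N.smul_ae ξ x
  rw [h] at hx
  filter_upwards [hx, N.smul_ae ξ y] with ω h1 h2 hω
  rw [h1] at h2
  exact mul_left_cancel₀ (abs_ne_zero.2 hω) h2

theorem eq_zero_of_ae {x : S} (h : ∀ᵐ ω ∂P, N x ω = 0) : x = 0 := by
  refine N.eq_zero' x (AEEqFun.ext ?_)
  filter_upwards [h, coe_zero (P := P)] with ω h1 h2
  rw [h1, h2]

theorem ind_smul_eq_zero {D : Event Ω} {x : S} (h : ∀ᵐ ω ∂P, ω ∈ (D : Set Ω) → N x ω = 0) :
    ind P D • x = 0 := by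
  refine N.eq_zero_of_ae ?_
  filter_upwards [N.smul_ae (ind P D) x, ind_ae (P := P) D, h] with ω h1 h2 h3
  rw [h1]
  by_cases hω : ω ∈ (D : Set Ω)
  · rw [h3 hω, mul_zero]
  · rw [h2.2 hω, abs_zero, zero_mul]

/-- The norm of the concatenation of `x` on `E` with `y` off `E`. -/
theorem concat_ae (E : Event Ω) (x y : S) :
    ∀ᵐ ω ∂P, (ω ∈ (E : Set Ω) → N (ind P E • x + (1 - ind P E) • y) ω = N x ω) ∧
      (ω ∉ (E : Set Ω) → N (ind P E • x + (1 - ind P E) • y) ω = N y ω) := by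
  have hE : ind P E * ind P E = ind P E := ind_mul_self E
  have h1 : ind P E • (ind P E • x + (1 - ind P E) • y) = ind P E • x := by
    linear_combination (norm := module) hE • x - hE • y
  have h2 : (1 - ind P E) • (ind P E • x + (1 - ind P E) • y) = (1 - ind P E) • y := by
    linear_combination (norm := module) -(hE • x) + hE • y
  filter_upwards [N.congr_ae h1, N.congr_ae h2, ind_ae (P := P) E, coe_sub 1 (ind P E),
    coe_one (P := P)] with ω h1 h2 h3 h4 h5
  refine ⟨fun hω => h1 ?_, fun hω => h2 ?_⟩
  · rw [h3.1 hω]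
    exact one_ne_zero
  · rw [h4, h5, h3.2 hω, sub_zero]
    exact one_ne_zero

/-! ### Countable concatenation and independent pairs -/

/-- In a complete module, countably many vectors can be concatenated along disjoint events. -/
theorem IsComplete.exists_concat [IsProbabilityMeasure P] {N : L0Norm P S} (hS : N.IsComplete)
    (E : ℕ → Event Ω) (hE : Pairwise fun m n => Disjoint (E m : Set Ω) (E n)) (x : ℕ → S) :
    ∃ z : S, ∀ n, ind P (E n) • z = ind P (E n) • x n := by
  let X : ℕ → S := fun k => ∑ i ∈ Finset.range k, ind P (E i) • x i
  have hX : ∀ n k, n < k → ind P (E n) • X k = ind P (E n) • x n := by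
    intro n k hnk
    rw [Finset.smul_sum, Finset.sum_eq_single n]
    · rw [smul_smul, ind_mul_self]
    · intro i _ hi
      rw [smul_smul, ind_mul_eq_zero fun ω h1 h2 => Set.disjoint_left.1 (hE hi) h2 h1, zero_smul]
    · intro hn
      exact absurd (Finset.mem_range.2 hnk) hn
  let F : ℕ → Event Ω := fun n => ⟨⋃ i ≥ n, (E i : Set Ω),
    MeasurableSet.iUnion fun i => MeasurableSet.iUnion fun _ => (E i).2⟩
  have hF : Filter.Tendsto (fun n => P.real (F n : Set Ω)) Filter.atTop (nhds 0) := by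
    have h := tendsto_measure_biUnion_Ici_zero_of_pairwise_disjoint (μ := P)
      (Es := fun n => (E n : Set Ω)) (fun n => (E n).2.nullMeasurableSet) hE
    exact (ENNReal.tendsto_toReal_zero_iff fun n => measure_ne_top P _).2 h
  have hXF : ∀ n k, n ≤ k → ∀ᵐ ω ∂P, ω ∉ (F n : Set Ω) → N (X k - X n) ω = 0 := by
    intro n k hnk
    have h : ind P (F n)ᶜ • (X k - X n) = 0 := by
      have h1 : X k - X n = ∑ i ∈ Finset.Ico n k, ind P (E i) • x i :=
        (Finset.sum_Ico_eq_sub _ hnk).symm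
      rw [h1, Finset.smul_sum]
      refine Finset.sum_eq_zero fun i hi => ?_
      rw [smul_smul, ind_mul_eq_zero, zero_smul]
      intro ω h1 h2
      exact h1 (Set.mem_biUnion (Finset.mem_Ico.1 hi).1 h2)
    have h0 := N.smul_ae (ind P (F n)ᶜ) (X k - X n)
    have h00 := N.smul_ae 0 (0 : S)
    rw [h] at h0
    rw [smul_zero] at h00
    filter_upwards [h0, h00, ind_ae (P := P) (F n)ᶜ, coe_zero (P := P)] with ω h1 h2 h3 h4 hω
    rw [h4, abs_zero, zero_mul] at h2
    rw [h2, h3.1 hω, abs_one, one_mul] at h1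
    exact h1.symm
  obtain ⟨z, hz⟩ := hS X <| by
    intro ε l hε hl _
    obtain ⟨n₀, hn₀⟩ := (hF.eventually (gt_mem_nhds hl)).exists
    refine ⟨n₀, fun m hm n hn => ?_⟩
    have h1 : P.real (F n₀ : Set Ω)ᶜ ≤ P.real {ω | N (X m - X n) ω < ε} := by
      refine ENNReal.toReal_mono (measure_ne_top P _) (measure_mono_ae ?_)
      have h2 := N.sub_ae (X m - X n₀) (X n - X n₀)
      rw [sub_sub_sub_cancel_right] at h2
      filter_upwards [h2, hXF n₀ m hm, hXF n₀ n hn] with ω h2 h3 h4 hω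
      rw [h3 hω, h4 hω, add_zero] at h2
      exact lt_of_le_of_lt h2 hε
    rw [probReal_compl_eq_one_sub (F n₀).2] at h1
    change 1 - l < P.real {ω | N (X m - X n) ω < ε}
    linarith
  refine ⟨z, fun n => ?_⟩
  rw [← sub_eq_zero, ← smul_sub]
  refine N.eq_zero_of_ae ?_
  have hlim : ∀ j : ℕ, ∀ᵐ ω ∂P, N (ind P (E n) • (z - x n)) ω < 1 / ((j : ℝ) + 1) := by
    intro j
    have hj : (0 : ℝ) < 1 / ((j : ℝ) + 1) := by positivity
    have hm : MeasurableSet {ω | N (ind P (E n) • (z - x n)) ω < 1 / ((j : ℝ) + 1)} :=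
      measurableSet_lt (measurable_coe _) measurable_const
    have h1 : ∀ l : ℝ, 0 < l → l < 1 →
        1 - l < P.real {ω | N (ind P (E n) • (z - x n)) ω < 1 / ((j : ℝ) + 1)} := by
      intro l hl hl1
      obtain ⟨n₀, hn₀⟩ := hz _ l hj hl hl1
      have h2 := hn₀ (max n₀ (n + 1)) (le_max_left _ _)
      refine lt_of_lt_of_le h2 (ENNReal.toReal_mono (measure_ne_top P _) (measure_mono_ae ?_))
      have h3 : ind P (E n) • (z - x n) = ind P (E n) • (z - X (max n₀ (n + 1))) := by
        rw [smul_sub, smul_sub, hX n _ (lt_of_lt_of_le n.lt_succ_self (le_max_right _ _))]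
      have h4 := N.smul_ae (ind P (E n)) (z - X (max n₀ (n + 1)))
      rw [← h3, N.sub_comm_eq] at h4
      filter_upwards [h4, ind_ae (P := P) (E n), N.nonneg_ae (X (max n₀ (n + 1)) - z)]
        with ω h4 h5 h6 h7
      change _ < _
      rw [h4]
      by_cases hω : ω ∈ (E n : Set Ω)
      · rw [h5.1 hω, abs_one, one_mul]
        exact h7
      · rw [h5.2 hω, abs_zero, zero_mul]
        exact hj
    have h8 : 1 ≤ P.real {ω | N (ind P (E n) • (z - x n)) ω < 1 / ((j : ℝ) + 1)} := by
      by_contra hlt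
      rw [not_le] at hlt
      have h0 : 0 ≤ P.real {ω | N (ind P (E n) • (z - x n)) ω < 1 / ((j : ℝ) + 1)} :=
        measureReal_nonneg
      have h9 := h1 ((1 - P.real {ω | N (ind P (E n) • (z - x n)) ω < 1 / ((j : ℝ) + 1)}) / 2)
        (by linarith) (by linarith)
      linarith
    refine (prob_compl_eq_zero_iff hm).2 ?_
    have h10 := le_antisymm measureReal_le_one h8
    rwa [measureReal_def, ENNReal.toReal_eq_one_iff] at h10
  filter_upwards [ae_all_iff.2 hlim, N.nonneg_ae (ind P (E n) • (z - x n))] with ω h1 h2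
  refine le_antisymm (le_of_forall_pos_lt_add fun r hr => ?_) h2
  obtain ⟨j, hj⟩ := exists_nat_one_div_lt hr
  linarith [h1 j]

theorem Indep.mono {D E : Event Ω} {x y : S} (h : Indep P E x y) (hDE : Incl P D E) :
    Indep P D x y := by
  have hi : ind P D * ind P E = ind P D := by
    refine AEEqFun.ext ?_
    filter_upwards [coe_mul (ind P D) (ind P E), ind_ae (P := P) D, ind_ae (P := P) E,
      incl_iff_ae.1 hDE] with ω h1 h2 h3 h4
    rw [h1]
    by_cases hω : ω ∈ (D : Set Ω)
    · rw [h3.1 (h4 hω), mul_one]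
    · rw [h2.2 hω, zero_mul]
  intro ξ η h0
  have h1 := h (ξ * ind P D) (η * ind P D)
  rw [mul_assoc, mul_assoc, hi] at h1
  exact h1 h0

/-- A complete module has an independent pair on all of `G(S)`. -/
theorem IsComplete.exists_indep [IsProbabilityMeasure P] {N : L0Norm P S} (hS : N.IsComplete)
    {D : Event Ω} (hD : Incl P D N.G) : ∃ x y : S, Indep P D x y := by
  suffices h : ∃ E, (∃ x y : S, Indep P E x y) ∧ ∀ F, (∃ x y : S, Indep P F x y) → Incl P F E by
    obtain ⟨E, ⟨x, y, hxy⟩, hmax⟩ := h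
    refine ⟨x, y, hxy.mono ?_⟩
    have hG : Incl P N.G E := by
      have h := (exists_isEssUnion P
        {D | Incl P D N.H ∧ 0 < P (D : Set Ω) ∧ RankGeTwo P S D}).choose_spec
      exact h.2 E fun F hF => hmax F hF.2.2
    rw [incl_iff_ae] at hD hG ⊢
    filter_upwards [hD, hG] with ω h1 h2 h3
    exact h2 (h1 h3)
  refine exists_maximal_event (P := P) (fun E => ∃ x y : S, Indep P E x y) ?_ ?_ ?_
  · refine ⟨0, 0, fun ξ η _ => ?_⟩
    have h : ind P (⊥ : Event Ω) = 0 := by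
      refine AEEqFun.ext ?_
      filter_upwards [ind_ae (P := P) (⊥ : Event Ω), coe_zero (P := P)] with ω h1 h2
      rw [h2]
      exact h1.2 fun h => h
    rw [h, mul_zero, mul_zero]
    exact ⟨rfl, rfl⟩
  · rintro D E hDE ⟨x, y, hxy⟩
    exact ⟨x, y, hxy.mono (incl_iff_ae.2 (Filter.Eventually.of_forall fun ω h => hDE h))⟩
  · intro D E hD hdisj hE
    choose x y hxy using hD
    obtain ⟨u, hu⟩ := hS.exists_concat D hdisj x
    obtain ⟨v, hv⟩ := hS.exists_concat D hdisj y
    refine ⟨u, v, fun ξ η h => ?_⟩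
    have hn : ∀ n, ind P E * ind P (D n) = ind P (D n) := by
      intro n
      refine AEEqFun.ext ?_
      filter_upwards [coe_mul (ind P E) (ind P (D n)), ind_ae (P := P) E,
        ind_ae (P := P) (D n)] with ω h1 h2 h3
      rw [h1]
      by_cases hω : ω ∈ (D n : Set Ω)
      · rw [h2.1 (hE ▸ Set.mem_iUnion_of_mem n hω), one_mul]
      · rw [h3.2 hω, mul_zero]
    have hz : ∀ n, ξ * ind P (D n) = 0 ∧ η * ind P (D n) = 0 := by
      intro n
      refine hxy n ξ η ?_
      have h1 := congrArg (fun z => ind P (D n) • z) h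
      simp only [smul_add, smul_zero, smul_smul] at h1
      have h2 : ∀ ζ : Ω →ₘ[P] ℝ, ind P (D n) * (ζ * ind P E) = ζ * ind P (D n) := fun ζ => by
        linear_combination ζ * hn n
      rwa [h2, h2, mul_smul, mul_smul, hu, hv, ← mul_smul, ← mul_smul] at h1
    have key : ∀ ζ : Ω →ₘ[P] ℝ, (∀ n, ζ * ind P (D n) = 0) → ζ * ind P E = 0 := by
      intro ζ hζ
      have h1 : ∀ n, ∀ᵐ ω ∂P, ω ∈ (D n : Set Ω) → ζ ω = 0 := by
        intro n
        have h2 := coe_mul ζ (ind P (D n))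
        rw [hζ n] at h2
        filter_upwards [h2, ind_ae (P := P) (D n), coe_zero (P := P)] with ω h2 h3 h4 hω
        rw [h4, h3.1 hω, mul_one] at h2
        exact h2.symm
      refine AEEqFun.ext ?_
      filter_upwards [ae_all_iff.2 h1, coe_mul ζ (ind P E), ind_ae (P := P) E,
        coe_zero (P := P)] with ω h1 h2 h3 h4
      rw [h2, h4]
      by_cases hω : ω ∈ (E : Set Ω)
      · rw [hE, Set.mem_iUnion] at hω
        obtain ⟨n, hn⟩ := hω
        rw [h1 n hn, zero_mul]
      · rw [h3.2 hω, mul_zero]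
    exact ⟨key ξ fun n => (hz n).1, key η fun n => (hz n).2⟩

/-- Where `x` is a multiple `ξ d` of `d`, the coefficient can only be `± ‖x‖ / ‖d‖`. This makes the
event on which `x` is a multiple of `d` explicit. -/
theorem exists_event_multiple (x d : S) :
    ∃ (E : Event Ω) (ξ : Ω →ₘ[P] ℝ), ind P E • x = (ind P E * ξ) • d ∧
      ∀ η : Ω →ₘ[P] ℝ, ∀ᵐ ω ∂P, ω ∉ (E : Set Ω) → N d ω ≠ 0 → N (x - η • d) ω ≠ 0 := by
  classical
  obtain ⟨l, hl⟩ := exists_ae_eq (P := P) ((measurable_coe (N x)).div (measurable_coe (N d)))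
  have hplus : MeasurableSet {ω | N (x - l • d) ω = 0} :=
    measurableSet_eq_fun (measurable_coe _) measurable_const
  have hminus : MeasurableSet {ω | N (x - (-l) • d) ω = 0} :=
    measurableSet_eq_fun (measurable_coe _) measurable_const
  obtain ⟨ξ, hξ⟩ := exists_ae_eq (P := P) (f := fun ω =>
    if N (x - l • d) ω = 0 then l ω else (-l) ω) <|
    Measurable.ite hplus (measurable_coe l) (measurable_coe (-l))
  let E : Event Ω := ⟨_, hplus.union hminus⟩
  refine ⟨E, ξ, ?_, fun η => ?_⟩
  · rw [mul_smul, ← sub_eq_zero, ← smul_sub]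
    refine N.ind_smul_eq_zero ?_
    filter_upwards [hξ, N.abs_sub_smul_ae x d ξ l, N.abs_sub_smul_ae x d ξ (-l)]
      with ω h1 h2 h3 hω
    by_cases hω' : N (x - l • d) ω = 0
    · rw [if_pos hω'] at h1
      rw [h1, hω', sub_self, abs_zero, zero_mul, sub_zero] at h2
      exact abs_nonpos_iff.1 h2
    · rw [if_neg hω'] at h1
      have hω'' : N (x - (-l) • d) ω = 0 := hω.resolve_left hω'
      rw [h1, hω'', sub_self, abs_zero, zero_mul, sub_zero] at h3
      exact abs_nonpos_iff.1 h3
  · filter_upwards [hl, coe_neg l, N.abs_sub_smul_ae x d l η, N.abs_sub_smul_ae x d (-l) η,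
      N.abs_sub_ae x (η • d), N.smul_ae η d] with ω h1 h2 h3 h4 h5 h6 hω hd h0
    rw [h0, h6] at h5
    have h7 : N x ω = |η ω| * N d ω := sub_eq_zero.1 (abs_nonpos_iff.1 h5)
    have h8 : l ω = |η ω| := by
      rw [h1, Pi.div_apply, h7, mul_div_cancel_right₀ _ hd]
    refine hω ?_
    rcases abs_choice (η ω) with h9 | h9
    · left
      rw [h0, h8, h9, sub_self, abs_zero, zero_mul, sub_zero] at h3
      exact abs_nonpos_iff.1 h3
    · right
      rw [h0, h2, h8, h9, neg_neg, sub_self, abs_zero, zero_mul, sub_zero] at h4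
      exact abs_nonpos_iff.1 h4

/-- A vector `d` that vanishes nowhere on `D` can be completed to a pair `d`, `w` that is
independent at every point of `D` and whose span contains a prescribed vector `x`. -/
theorem exists_complement {D : Event Ω} {x₀ y₀ : S} (h : Indep P D x₀ y₀) (x d : S)
    (hd : ∀ᵐ ω ∂P, ω ∈ (D : Set Ω) → N d ω ≠ 0) :
    ∃ (w : S) (a b : Ω →ₘ[P] ℝ), x = a • d + b • w ∧
      ∀ η : Ω →ₘ[P] ℝ, ∀ᵐ ω ∂P, ω ∈ (D : Set Ω) → N (w - η • d) ω ≠ 0 := by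
  obtain ⟨E, ξ, hE, hE'⟩ := N.exists_event_multiple x d
  obtain ⟨F, ζ, hF, hF'⟩ := N.exists_event_multiple x₀ d
  have hEE : ind P E * ind P E = ind P E := ind_mul_self E
  have hy₀ : ∀ η : Ω →ₘ[P] ℝ, ∀ᵐ ω ∂P, ω ∈ (F : Set Ω) → ω ∈ (D : Set Ω) →
      N (y₀ - η • d) ω ≠ 0 := by
    intro η
    let K : Event Ω := ⟨{ω | N (y₀ - η • d) ω = 0} ∩ (F ∩ D),
      (measurableSet_eq_fun (measurable_coe _) measurable_const).inter (F.2.inter D.2)⟩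
    have hKF : ind P K * ind P F = ind P K := by
      refine AEEqFun.ext ?_
      filter_upwards [coe_mul (ind P K) (ind P F), ind_ae (P := P) K, ind_ae (P := P) F]
        with ω h1 h2 h3
      rw [h1]
      by_cases hω : ω ∈ (K : Set Ω)
      · rw [h3.1 hω.2.1, mul_one]
      · rw [h2.2 hω, zero_mul]
    have hKD : ind P K * ind P D = ind P K := by
      refine AEEqFun.ext ?_
      filter_upwards [coe_mul (ind P K) (ind P D), ind_ae (P := P) K, ind_ae (P := P) D]
        with ω h1 h2 h3
      rw [h1]
      by_cases hω : ω ∈ (K : Set Ω)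
      · rw [h3.1 hω.2.2, mul_one]
      · rw [h2.2 hω, zero_mul]
    have hKy : ind P K • (y₀ - η • d) = 0 :=
      N.ind_smul_eq_zero (Filter.Eventually.of_forall fun ω hω => hω.1)
    have hKx : ind P K • x₀ = (ind P K * ζ) • d := by
      rw [← hKF, mul_smul, hF]
      module
    obtain ⟨-, h2⟩ := h (ind P K * η) (-(ind P K * ζ)) <| by
      linear_combination (norm := module) (η * ind P D) • hKx - (ζ * ind P D) • hKy
    have h3 : ind P K * ζ = 0 := by linear_combination -h2 - ζ * hKD
    rw [h3, zero_smul] at hKx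
    obtain ⟨h4, -⟩ := h (ind P K) 0 <| by
      rw [hKD, hKx]
      module
    rw [hKD] at h4
    filter_upwards [ind_ae (P := P) K, coe_zero (P := P)] with ω h5 h6 hωF hωD h7
    have h8 := h5.1 ⟨h7, hωF, hωD⟩
    rw [h4, h6] at h8
    exact zero_ne_one h8
  refine ⟨ind P E • (ind P F • y₀ + (1 - ind P F) • x₀) + (1 - ind P E) • x,
    ind P E * ξ, 1 - ind P E, ?_, fun η => ?_⟩
  · rw [← hE]
    linear_combination (norm := module) hEE • (ind P F • y₀ + (1 - ind P F) • x₀) - hEE • x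
  · have h1 := N.concat_ae E (ind P F • y₀ + (1 - ind P F) • x₀ - η • d) (x - η • d)
    have h2 := N.concat_ae F (y₀ - η • d) (x₀ - η • d)
    rw [show ind P F • (y₀ - η • d) + (1 - ind P F) • (x₀ - η • d) =
      ind P F • y₀ + (1 - ind P F) • x₀ - η • d by module] at h2
    rw [show ∀ z : S, ind P E • (z - η • d) + (1 - ind P E) • (x - η • d) =
      ind P E • z + (1 - ind P E) • x - η • d from fun z => by module] at h1
    filter_upwards [h1, h2, hd, hE' η, hF' η, hy₀ η] with ω h1 h2 h3 h4 h5 h6 hω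
    by_cases hωE : ω ∈ (E : Set Ω)
    · rw [h1.1 hωE]
      by_cases hωF : ω ∈ (F : Set Ω)
      · rw [h2.1 hωF]
        exact h6 hωF hω
      · rw [h2.2 hωF]
        exact h5 hωF (h3 hω)
    · rw [h1.2 hωE]
      exact h4 hωE (h3 hω)

/-! ### Segments with both endpoints on the random unit sphere -/

theorem smul_add_smul_ae (ξ η : Ω →ₘ[P] ℝ) (x y : S) :
    ∀ᵐ ω ∂P, N (ξ • x + η • y) ω ≤ |ξ ω| * N x ω + |η ω| * N y ω := by
  filter_upwards [N.add_ae (ξ • x) (η • y), N.smul_ae ξ x, N.smul_ae η y] with ω h1 h2 h3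
  rwa [h2, h3] at h1

theorem add_self_ae (x : S) : ∀ᵐ ω ∂P, N (x + x) ω = 2 * N x ω := by
  have h := N.smul_ae 2 x
  rw [two_smul] at h
  filter_upwards [h, coe_two (P := P)] with ω h1 h2
  rw [h1, h2, abs_two]

/-- A form of the monotonicity lemma for normed planes, with the segments given by their
difference vector `d` and twice their midpoints `m` and `m'`. -/
theorem norm_le_of_nonneg_combination {d m m' : S} {a b c : Ω →ₘ[P] ℝ}
    (h : c • m = a • d + b • m') :
    ∀ᵐ ω ∂P, 0 < c ω → 0 ≤ a ω → 0 ≤ b ω → N (m' + d) ω = 2 → N (m + d) ω ≤ 2 → N d ω < 2 →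
      N m ω ≤ N m' ω := by
  have h1 := N.smul_add_smul_ae a b (m + d) m'
  rw [show a • (m + d) + b • m' = (c + a) • m by
    linear_combination (norm := module) -h] at h1
  have h2 := N.smul_add_smul_ae (c + a - b) c m' (m + d)
  rw [show (c + a - b) • m' + c • (m + d) = (c + a) • (m' + d) by
    linear_combination (norm := module) h] at h2
  have h3 := N.smul_add_smul_ae c (b - (a + c)) (m + d) d
  rw [show c • (m + d) + (b - (a + c)) • d = b • (m' + d) by
    linear_combination (norm := module) h] at h3
  filter_upwards [h1, h2, h3, N.smul_ae (c + a) m, N.smul_ae (c + a) (m' + d),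
    N.smul_ae b (m' + d), coe_add c a, coe_add a c, coe_sub (c + a) b, coe_sub b (a + c),
    N.nonneg_ae m'] with ω h1 h2 h3 h4 h5 h6 h7 h8 h9 h10 h11 hc ha hb hm' hm hd
  rw [h4, h7, abs_of_pos (by linarith), abs_of_nonneg ha, abs_of_nonneg hb] at h1
  rw [h5, h7, h9, h7, hm', abs_of_pos (by linarith), abs_of_pos hc] at h2
  rw [h6, h10, h8, hm', abs_of_pos hc, abs_of_nonneg hb] at h3
  have hcm : c ω * N (m + d) ω ≤ c ω * 2 := mul_le_mul_of_nonneg_left hm hc.le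
  have ham : a ω * N (m + d) ω ≤ a ω * 2 := mul_le_mul_of_nonneg_left hm ha
  rcases le_or_gt (b ω) (a ω + c ω) with hbc | hbc
  · -- The segments from `0` to `(m + d) / 2` and from `d / 2` to `(m' + d) / 2` cross; add the
    -- triangle inequalities through the crossing point.
    rw [abs_of_nonneg (by linarith)] at h2
    have h12 : (c ω + a ω) * N m ω ≤ (c ω + a ω) * N m' ω := by linarith
    exact le_of_mul_le_mul_left h12 (by linarith)
  · -- Otherwise `(m' + d) / 2` is a combination of `(m + d) / 2` and `d / 2` whose coefficients are
    -- nonnegative and have sum at most `1`; its norm is less than `1` because that of `d / 2` is.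
    rw [abs_of_pos (by linarith)] at h3
    have h12 : (b ω - (a ω + c ω)) * N d ω < (b ω - (a ω + c ω)) * 2 :=
      mul_lt_mul_of_pos_left hd (by linarith)
    linarith

/-- Among the segments in the unit ball of a normed plane with a given difference vector `d` shorter
than the diameter, one with both endpoints on the sphere has midpoint of the greatest norm. -/
theorem norm_le_of_combination {d m m' : S} {a b c : Ω →ₘ[P] ℝ} (h : c • m = a • d + b • m') :
    ∀ᵐ ω ∂P, 0 < c ω → N (m' + d) ω = 2 → N (m' - d) ω = 2 → N (m + d) ω ≤ 2 →
      N (m - d) ω ≤ 2 → N d ω < 2 → N m ω ≤ N m' ω := by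
  have h1 := N.norm_le_of_nonneg_combination h
  have h2 := N.norm_le_of_nonneg_combination (d := -d) (m := m) (m' := m') (a := -a) (b := b)
    (c := c) (by linear_combination (norm := module) h)
  have h3 := N.norm_le_of_nonneg_combination (d := d) (m := -m) (m' := m') (a := -a) (b := -b)
    (c := c) (by linear_combination (norm := module) -h)
  have h4 := N.norm_le_of_nonneg_combination (d := -d) (m := -m) (m' := m') (a := a) (b := -b)
    (c := c) (by linear_combination (norm := module) -h)
  have e1 : N (-m + d) = N (m - d) := by rw [← N.neg_eq (m - d)]; congr 1; abel
  have e2 : N (-m + -d) = N (m + d) := by rw [← N.neg_eq (m + d)]; congr 1; abel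
  rw [N.neg_eq] at h2 h3 h4
  rw [N.neg_eq] at h4
  rw [e1] at h3
  rw [e2] at h4
  simp only [← sub_eq_add_neg] at h2 h4
  filter_upwards [h1, h2, h3, h4, coe_neg a, coe_neg b] with ω h1 h2 h3 h4 ha hb hc k1 k2 k3 k4 k5
  rw [ha] at h2 h3
  rw [hb] at h3 h4
  rcases le_total 0 (a ω) with ha | ha <;> rcases le_total 0 (b ω) with hb | hb
  · exact h1 hc ha hb k1 k3 k5
  · exact h4 hc ha (neg_nonneg.2 hb) k2 k3 k5
  · exact h2 hc (neg_nonneg.2 ha) hb k2 k4 k5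
  · exact h3 hc (neg_nonneg.2 ha) (neg_nonneg.2 hb) k1 k4 k5

/-- In a plane, a vector `d` shorter than the diameter is the difference of two unit vectors `u` and
`u - d`, and the sum of these is at least as long as any `m` in the plane for which
`(m ± d) / 2` lie in the unit ball. -/
theorem exists_unit_sub_unit [IsFiniteMeasure P] {D : Event Ω} {x₀ y₀ : S} (hD : Indep P D x₀ y₀)
    (m d : S) (hd : ∀ᵐ ω ∂P, ω ∈ (D : Set Ω) → 0 < N d ω ∧ N d ω ≤ 2) :
    ∃ u : S, ∀ᵐ ω ∂P, ω ∈ (D : Set Ω) → N d ω < 2 → N u ω = 1 ∧ N (u - d) ω = 1 ∧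
      (N (m + d) ω ≤ 2 → N (m - d) ω ≤ 2 → N m ω ≤ N (u + (u - d)) ω) := by
  obtain ⟨w, a, b, hm, hw⟩ := N.exists_complement hD m d
    (by filter_upwards [hd] with ω h hω using (h hω).1.ne')
  have abs_one' : |(1 : Ω →ₘ[P] ℝ)| = 1 := by
    refine AEEqFun.ext ?_
    filter_upwards [coe_abs (1 : Ω →ₘ[P] ℝ), coe_one (P := P)] with ω h1 h2
    rw [h1, h2, abs_one]
  -- The path `q` leads from `d` through `w` to `-d`; the unit vector in the direction of `q s` has
  -- distance `1` from `d` when `h s = 0`.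
  let q : (Ω →ₘ[P] ℝ) → S := fun s => (-s) • d + (1 - |s|) • w
  let h : (Ω →ₘ[P] ℝ) → (Ω →ₘ[P] ℝ) := fun s => N (q s - N (q s) • d) - N (q s)
  obtain ⟨C, hC⟩ := exists_ae_eq (P := P) (((measurable_coe (N d)).add (measurable_coe (N w))).mul
    ((measurable_coe (N d)).add_const 2))
  have hlip : ∀ s t, ∀ᵐ ω ∂P, |h s ω - h t ω| ≤ C ω * |s ω - t ω| := by
    intro s t
    have h1 := N.smul_add_smul_ae (t - s) (|t| - |s|) d w
    rw [show (t - s) • d + (|t| - |s|) • w = q s - q t by simp only [q]; module] at h1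
    have h2 := N.abs_sub_ae (q s - N (q s) • d) (q t - N (q t) • d)
    have h3 := N.sub_ae (q s - q t) ((N (q s) - N (q t)) • d)
    rw [show q s - q t - (N (q s) - N (q t)) • d =
      q s - N (q s) • d - (q t - N (q t) • d) by module] at h3
    filter_upwards [hC, h1, h2, h3, N.smul_ae (N (q s) - N (q t)) d, coe_sub t s,
      coe_sub |t| |s|, coe_abs t, coe_abs s, coe_sub (N (q s)) (N (q t)),
      coe_sub (N (q s - N (q s) • d)) (N (q s)), coe_sub (N (q t - N (q t) • d)) (N (q t)),
      N.abs_sub_ae (q s) (q t), N.nonneg_ae d, N.nonneg_ae w]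
      with ω hC h1 h2 h3 h4 h5 h6 h7 h8 h9 h10 h11 h12 h13 h14
    simp only [Pi.mul_apply, Pi.add_apply] at hC
    rw [h5, h6, h7, h8] at h1
    have h15 : N (q s - q t) ω ≤ |s ω - t ω| * (N d ω + N w ω) := by
      have h16 : |(|t ω| - |s ω|)| ≤ |s ω - t ω| := by
        rw [abs_sub_comm (s ω)]
        exact abs_abs_sub_abs_le _ _
      rw [abs_sub_comm (t ω)] at h1
      linarith [mul_le_mul_of_nonneg_right h16 h14]
    rw [h4, h9] at h3
    have h17 := mul_le_mul_of_nonneg_right h12 h13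
    have h18 : |h s ω - h t ω| ≤ |N (q s - N (q s) • d) ω - N (q t - N (q t) • d) ω| +
        |N (q s) ω - N (q t) ω| := by
      simp only [h]
      rw [h10, h11, sub_sub_sub_comm]
      exact abs_sub _ _
    have h19 := mul_le_mul_of_nonneg_right h15 (by linarith : 0 ≤ N d ω + 2)
    rw [hC]
    linarith
  have hlo : ∀ᵐ ω ∂P, h (-1) ω = |1 - N d ω| * N d ω - N d ω := by
    have hq : q (-1) = d := by
      simp only [q]
      rw [abs_neg, abs_one', neg_neg, sub_self, zero_smul, add_zero, one_smul]
    have h1 := N.smul_ae (1 - N d) d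
    rw [show (1 - N d) • d = d - N d • d by module] at h1
    simp only [h, hq]
    filter_upwards [h1, coe_sub (N (d - N d • d)) (N d), coe_sub 1 (N d), coe_one (P := P)]
      with ω h1 h2 h3 h4
    rw [h2, h1, h3, h4]
  have hhi : ∀ᵐ ω ∂P, h 1 ω = |1 + N d ω| * N d ω - N d ω := by
    have hq : q 1 = -d := by
      simp only [q]
      rw [abs_one', sub_self, zero_smul, add_zero, neg_one_smul]
    have h1 := N.smul_ae (1 + N d) d
    rw [← N.neg_eq, show -((1 + N d) • d) = -d - N d • d by module] at h1
    simp only [h, hq, N.neg_eq d]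
    filter_upwards [h1, coe_sub (N (-d - N d • d)) (N d), coe_add 1 (N d), coe_one (P := P)]
      with ω h1 h2 h3 h4
    rw [h2, h1, h3, h4]
  obtain ⟨s, hs1, hs⟩ := exists_random_zero D h C hlip
    (by
      filter_upwards [hlo, hd] with ω h1 h2 hω
      obtain ⟨h3, h4⟩ := h2 hω
      have h5 : |1 - N d ω| ≤ 1 := abs_le.2 ⟨by linarith, by linarith⟩
      rw [h1]
      linarith [mul_le_mul_of_nonneg_right h5 h3.le])
    (by
      filter_upwards [hhi, hd] with ω h1 h2 hω
      obtain ⟨h3, h4⟩ := h2 hω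
      rw [h1, abs_of_pos (by linarith)]
      linarith [mul_pos h3 h3])
  -- A zero with `|s| = 1` would force `‖d‖ = 2`.
  have hs_lt : ∀ᵐ ω ∂P, ω ∈ (D : Set Ω) → N d ω < 2 → 0 < 1 - |s ω| := by
    filter_upwards [hs1, hs, hlo, hhi, hd, hlip s (-1), hlip s 1, coe_neg (1 : Ω →ₘ[P] ℝ),
      coe_one (P := P)] with ω k1 k2 k3 k4 k5 k6 k7 k8 k9 hω hω2
    obtain ⟨k10, -⟩ := k5 hω
    rw [sub_pos]
    refine lt_of_le_of_ne (abs_le.2 k1) fun habs => ?_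
    rw [k2 hω, zero_sub, abs_neg] at k6 k7
    rcases (abs_eq zero_le_one).1 habs with h11 | h11
    · rw [h11, k9, sub_self, abs_zero, mul_zero, abs_nonpos_iff, k4, abs_of_pos (by linarith)] at k7
      linarith [mul_pos k10 k10]
    · rw [h11, k8, k9, sub_self, abs_zero, mul_zero, abs_nonpos_iff, k3] at k6
      have h12 : |1 - N d ω| = 1 := by
        have h13 : (|1 - N d ω| - 1) * N d ω = 0 := by linarith
        rcases mul_eq_zero.1 h13 with h14 | h14
        · linarith
        · exact absurd h14 k10.ne'
      rcases (abs_eq zero_le_one).1 h12 with h14 | h14 <;> linarith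
  have hq_pos : ∀ᵐ ω ∂P, ω ∈ (D : Set Ω) → N d ω < 2 → 0 < N (q s) ω := by
    obtain ⟨η, hη⟩ := exists_ae_eq (P := P)
      ((measurable_coe s).div ((measurable_coe s).abs.const_sub 1))
    have h1 := N.smul_ae ((1 - |s|) * η - s) d
    have h2 := N.abs_sub_ae (q s) ((1 - |s|) • (w - η • d))
    rw [show q s - (1 - |s|) • (w - η • d) = ((1 - |s|) * η - s) • d by
      simp only [q]; module] at h2
    filter_upwards [hη, h1, h2, hs_lt, hw η, N.smul_ae (1 - |s|) (w - η • d), N.nonneg_ae (q s),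
      coe_sub ((1 - |s|) * η) s, coe_mul (1 - |s|) η, coe_sub 1 |s|, coe_abs s, coe_one (P := P)]
      with ω hη h1 h2 h3 h4 h5 h6 h7 h8 h9 h10 h11 hω hω2
    have h12 := h3 hω hω2
    rw [Pi.div_apply] at hη
    rw [h7, h8, h9, h10, h11, hη, mul_div_cancel₀ _ h12.ne', sub_self, abs_zero, zero_mul] at h1
    rw [h1, abs_nonpos_iff, sub_eq_zero, h5, h9, h10, h11] at h2
    refine lt_of_le_of_ne h6 ?_
    rw [h2]
    exact (mul_ne_zero (abs_ne_zero.2 h12.ne') (h4 hω)).symm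
  obtain ⟨κ, hκ⟩ := exists_ae_eq (P := P) (measurable_coe (N (q s))).inv
  refine ⟨κ • q s, ?_⟩
  have hcomb : (κ * (1 - |s|) + κ * (1 - |s|)) • m =
      ((κ * (1 - |s|) + κ * (1 - |s|)) * a + b * (1 + κ * s + κ * s)) • d +
        b • (κ • q s + (κ • q s - d)) := by
    rw [hm]
    simp only [q]
    module
  have h1 := N.norm_le_of_combination hcomb
  rw [show κ • q s + (κ • q s - d) + d = κ • q s + κ • q s by abel,
    show κ • q s + (κ • q s - d) - d = (κ • q s - d) + (κ • q s - d) by abel] at h1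
  have h2 := N.abs_sub_smul_ae (κ • q s) d 1 (κ * N (q s))
  rw [one_smul, show κ • q s - (κ * N (q s)) • d = κ • (q s - N (q s) • d) by module] at h2
  filter_upwards [h1, h2, hs, hs_lt, hq_pos, hκ, N.smul_ae κ (q s),
    N.smul_ae κ (q s - N (q s) • d), coe_sub (N (q s - N (q s) • d)) (N (q s)),
    coe_mul κ (N (q s)), coe_one (P := P), N.add_self_ae (κ • q s), N.add_self_ae (κ • q s - d),
    coe_add (κ * (1 - |s|)) (κ * (1 - |s|)), coe_mul κ (1 - |s|), coe_sub 1 |s|, coe_abs s]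
    with ω k1 k2 k3 k4 k5 k6 k7 k8 k9 k10 k11 k12 k13 k14 k15 k16 k17 hω hω2
  rw [Pi.inv_apply] at k6
  have hq0 := k5 hω hω2
  have hκ0 : 0 < κ ω := k6 ▸ inv_pos.2 hq0
  have hκq : κ ω * N (q s) ω = 1 := by rw [k6, inv_mul_cancel₀ hq0.ne']
  have hu : N (κ • q s) ω = 1 := by rw [k7, abs_of_pos hκ0, hκq]
  have hq1 : N (q s - N (q s) • d) ω = N (q s) ω := by
    have := k3 hω
    simp only [h] at this
    rw [k9] at this
    linarith
  have hud : N (κ • q s - d) ω = 1 := by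
    rw [k10, k11, hκq, sub_self, abs_zero, zero_mul, abs_nonpos_iff, sub_eq_zero, k8, hq1,
      abs_of_pos hκ0, hκq] at k2
    exact k2
  refine ⟨hu, hud, fun k18 k19 => k1 ?_ ?_ ?_ k18 k19 hω2⟩
  · rw [k14, k15, k16, k17, k11]
    have := mul_pos hκ0 (k4 hω hω2)
    linarith
  · rw [k12, hu, mul_one]
  · rw [k13, hud, mul_one]

/-! ### Comparison of the three families -/

theorem Indep.norm_ne_zero {D : Event Ω} {x y : S} (h : Indep P D x y) :
    ∀ᵐ ω ∂P, ω ∈ (D : Set Ω) → N x ω ≠ 0 := by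
  let K : Event Ω := ⟨{ω | N x ω = 0}, measurableSet_eq_fun (measurable_coe _) measurable_const⟩
  have hK : ind P K • x = 0 :=
    N.ind_smul_eq_zero (Filter.Eventually.of_forall fun ω hω => hω)
  obtain ⟨h1, -⟩ := h (ind P K) 0 <| by
    linear_combination (norm := module) ind P D • hK
  have h2 := coe_mul (ind P K) (ind P D)
  rw [h1] at h2
  filter_upwards [h2, ind_ae (P := P) K, ind_ae (P := P) D, coe_zero (P := P)]
    with ω h2 h3 h4 h5 hω h0
  rw [h5, h3.1 h0, h4.1 hω, one_mul] at h2
  exact zero_ne_one h2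

theorem ind_smul_ae (D : Event Ω) (x : S) :
    ∀ᵐ ω ∂P, (ω ∈ (D : Set Ω) → N (ind P D • x) ω = N x ω) ∧
      (ω ∉ (D : Set Ω) → N (ind P D • x) ω = 0) := by
  filter_upwards [N.smul_ae (ind P D) x, ind_ae (P := P) D] with ω h1 h2
  rw [h1]
  refine ⟨fun hω => ?_, fun hω => ?_⟩
  · rw [h2.1 hω, abs_one, one_mul]
  · rw [h2.2 hω, abs_zero, zero_mul]

theorem norm_half_ae [Module ℝ S] (x : S) : ∀ᵐ ω ∂P, N ((2⁻¹ : ℝ) • x) ω = N x ω / 2 := by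
  have h := N.add_self_ae ((2⁻¹ : ℝ) • x)
  rw [show (2⁻¹ : ℝ) • x + (2⁻¹ : ℝ) • x = x by module] at h
  filter_upwards [h] with ω h
  rw [h, mul_div_cancel_left₀ _ two_ne_zero]

theorem mem_ball_ae {x : S} (hx : x ∈ N.ball) : ∀ᵐ ω ∂P, N x ω ≤ 1 := by
  filter_upwards [le_iff_ae.1 hx, coe_one (P := P)] with ω h1 h2
  rwa [h2] at h1

theorem sphere_subset_ball : N.sphere ⊆ N.ball := by
  rintro x ⟨E, -, hE⟩
  refine le_iff_ae.2 ?_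
  rw [hE]
  filter_upwards [ind_ae (P := P) E, coe_one (P := P)] with ω h1 h2
  rw [h2]
  by_cases hω : ω ∈ (E : Set Ω)
  · rw [h1.1 hω]
  · rw [h1.2 hω]
    exact zero_le_one

theorem mem_sphere_of_ae {D : Event Ω} (hD : 0 < P (D : Set Ω)) {x : S}
    (hx : ∀ᵐ ω ∂P, ω ∈ (D : Set Ω) → N x ω = 1) : ind P D • x ∈ N.sphere := by
  refine ⟨D, hD, AEEqFun.ext ?_⟩
  filter_upwards [N.ind_smul_ae D x, ind_ae (P := P) D, hx] with ω h1 h2 h3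
  by_cases hω : ω ∈ (D : Set Ω)
  · rw [h1.1 hω, h2.1 hω, h3 hω]
  · rw [h1.2 hω, h2.2 hω]

section Modulus

variable [Module ℝ S] {D : Event Ω} {ε : Ω →ₘ[P] ℝ}

theorem deltaSet₁_subset : N.deltaSet₁ D ε ⊆ N.deltaSet D ε := by
  rintro ζ ⟨x, hx, y, hy, hB, h, hζ⟩
  exact ⟨x, hx, y, hy, hB, h.ge, hζ⟩

theorem deltaSet_subset : N.deltaSet D ε ⊆ N.deltaSet₂ D ε := by
  rintro ζ ⟨x, hx, y, hy, hB, h, hζ⟩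
  exact ⟨x, N.sphere_subset_ball hx, y, N.sphere_subset_ball hy, hB, h, hζ⟩

theorem zero_mem_lowerBounds_deltaSet₂ : 0 ∈ lowerBounds (N.deltaSet₂ D ε) := by
  rintro _ ⟨x, hx, y, hy, -, -, rfl⟩
  refine le_iff_ae.2 ?_
  filter_upwards [N.mem_ball_ae hx, N.mem_ball_ae hy, N.norm_half_ae (x + y), N.add_ae x y,
    ind_ae (P := P) D, coe_zero (P := P), coe_sub (ind P D) (ind P D * N ((2⁻¹ : ℝ) • (x + y))),
    coe_mul (ind P D) (N ((2⁻¹ : ℝ) • (x + y)))] with ω h1 h2 h3 h4 h5 h6 h7 h8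
  rw [h6, h7, h8, h3]
  by_cases hω : ω ∈ (D : Set Ω)
  · rw [h5.1 hω]
    linarith
  · rw [h5.2 hω, zero_mul, sub_self]

theorem deltaSet₂_nonempty {x₀ y₀ : S} (h : Indep P D x₀ y₀)
    (hε : ∀ᵐ ω ∂P, ω ∈ (D : Set Ω) → 0 < ε ω ∧ ε ω ≤ 2) : (N.deltaSet₂ D ε).Nonempty := by
  obtain ⟨ξ, hξ⟩ := exists_ae_eq (P := P)
    ((measurable_coe ε).div ((measurable_coe (N x₀)).const_mul 2))
  let x : S := ind P D • ξ • x₀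
  have hx : ∀ᵐ ω ∂P, (ω ∈ (D : Set Ω) → N x ω = ε ω / 2) ∧ (ω ∉ (D : Set Ω) → N x ω = 0) := by
    filter_upwards [hξ, N.ind_smul_ae D (ξ • x₀), N.smul_ae ξ x₀, N.nonneg_ae x₀,
      h.norm_ne_zero N, hε] with ω h1 h2 h3 h4 h5 h6
    refine ⟨fun hω => ?_, h2.2⟩
    have h7 : 0 < N x₀ ω := lt_of_le_of_ne h4 (h5 hω).symm
    rw [Pi.div_apply] at h1
    rw [h2.1 hω, h3, h1, abs_of_pos (div_pos (h6 hω).1 (by linarith))]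
    field_simp
  have hx1 : x ∈ N.ball := by
    refine le_iff_ae.2 ?_
    filter_upwards [hx, hε, coe_one (P := P)] with ω h1 h2 h3
    rw [h3]
    by_cases hω : ω ∈ (D : Set Ω)
    · rw [h1.1 hω]
      linarith [(h2 hω).2]
    · rw [h1.2 hω]
      exact zero_le_one
  have hxx : ∀ᵐ ω ∂P, N (x - -x) ω = 2 * N x ω := by
    rw [sub_neg_eq_add]
    exact N.add_self_ae x
  refine ⟨_, x, hx1, -x, ?_, ?_, ?_, rfl⟩
  · change N (-x) ≤ 1
    rw [N.neg_eq]
    exact hx1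
  · refine incl_iff_ae.2 ?_
    filter_upwards [hx, hε, hxx] with ω h1 h2 h3 hω
    change (0 < N x ω ∧ 0 < N (-x) ω) ∧ 0 < N (x - -x) ω
    rw [N.neg_eq, h3, h1.1 hω]
    have := (h2 hω).1
    refine ⟨⟨?_, ?_⟩, ?_⟩ <;> linarith
  · refine le_iff_ae.2 ?_
    filter_upwards [hx, hxx, ind_ae (P := P) D, coe_mul ε (ind P D),
      coe_mul (ind P D) (N (x - -x))] with ω h1 h2 h3 h4 h5
    rw [h4, h5, h2]
    by_cases hω : ω ∈ (D : Set Ω)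
    · rw [h1.1 hω, h3.1 hω]
      linarith
    · rw [h3.2 hω, mul_zero, zero_mul]

/-- A pair in the unit ball at distance at least `ε` is improved to a pair on the unit sphere at
distance exactly `ε`, without making the sum of the pair shorter. -/
theorem exists_mem_deltaSet₁_le [IsFiniteMeasure P] {x₀ y₀ : S} (h : Indep P D x₀ y₀)
    (hD : 0 < P (D : Set Ω)) (hε : ∀ᵐ ω ∂P, ω ∈ (D : Set Ω) → 0 < ε ω ∧ ε ω ≤ 2)
    {ζ : Ω →ₘ[P] ℝ} (hζ : ζ ∈ N.deltaSet₂ D ε) : ∃ ζ' ∈ N.deltaSet₁ D ε, ζ' ≤ ζ := by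
  obtain ⟨x, hx, y, hy, -, hxy, rfl⟩ := hζ
  replace hx := N.mem_ball_ae hx
  replace hy := N.mem_ball_ae hy
  have hxy' : ∀ᵐ ω ∂P, ω ∈ (D : Set Ω) → ε ω ≤ N (x - y) ω := by
    filter_upwards [le_iff_ae.1 hxy, coe_mul ε (ind P D), coe_mul (ind P D) (N (x - y)),
      ind_ae (P := P) D] with ω h1 h2 h3 h4 hω
    rwa [h2, h3, h4.1 hω, mul_one, one_mul] at h1
  -- Shrink the segment about its midpoint to the length `ε`.
  obtain ⟨t, ht⟩ := exists_ae_eq (P := P) ((measurable_coe ε).div (measurable_coe (N (x - y))))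
  have ht' : ∀ᵐ ω ∂P, ω ∈ (D : Set Ω) → 0 < t ω ∧ t ω ≤ 1 ∧ t ω * N (x - y) ω = ε ω := by
    filter_upwards [ht, hε, hxy'] with ω h1 h2 h3 hω
    have h4 : 0 < N (x - y) ω := (h2 hω).1.trans_le (h3 hω)
    rw [Pi.div_apply] at h1
    rw [h1]
    exact ⟨div_pos (h2 hω).1 h4, (div_le_one h4).2 (h3 hω), div_mul_cancel₀ _ h4.ne'⟩
  let d : S := t • (x - y)
  have hd : ∀ᵐ ω ∂P, ω ∈ (D : Set Ω) → N d ω = ε ω := by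
    filter_upwards [ht', N.smul_ae t (x - y)] with ω h1 h2 hω
    rw [h2, abs_of_pos (h1 hω).1, (h1 hω).2.2]
  obtain ⟨u, hu⟩ := N.exists_unit_sub_unit h (x + y) d (by
    filter_upwards [hd, hε] with ω h1 h2 hω
    rw [h1 hω]
    exact h2 hω)
  have hplus : ∀ᵐ ω ∂P, ω ∈ (D : Set Ω) → N (x + y + d) ω ≤ 2 := by
    have h1 := N.smul_add_smul_ae (1 + t) (1 - t) x y
    rw [show (1 + t) • x + (1 - t) • y = x + y + d by simp only [d]; module] at h1
    filter_upwards [h1, ht', coe_add 1 t, coe_sub 1 t, coe_one (P := P), hx, hy]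
      with ω h1 h2 h3 h4 h5 h6 h7 hω
    obtain ⟨h8, h9, -⟩ := h2 hω
    rw [h3, h4, h5, abs_of_nonneg (by linarith), abs_of_nonneg (by linarith)] at h1
    have h10 := mul_le_mul_of_nonneg_left h6 (by linarith : 0 ≤ 1 + t ω)
    have h11 := mul_le_mul_of_nonneg_left h7 (by linarith : 0 ≤ 1 - t ω)
    linarith
  have hminus : ∀ᵐ ω ∂P, ω ∈ (D : Set Ω) → N (x + y - d) ω ≤ 2 := by
    have h1 := N.smul_add_smul_ae (1 - t) (1 + t) x y
    rw [show (1 - t) • x + (1 + t) • y = x + y - d by simp only [d]; module] at h1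
    filter_upwards [h1, ht', coe_add 1 t, coe_sub 1 t, coe_one (P := P), hx, hy]
      with ω h1 h2 h3 h4 h5 h6 h7 hω
    obtain ⟨h8, h9, -⟩ := h2 hω
    rw [h3, h4, h5, abs_of_nonneg (by linarith), abs_of_nonneg (by linarith)] at h1
    have h10 := mul_le_mul_of_nonneg_left h7 (by linarith : 0 ≤ 1 + t ω)
    have h11 := mul_le_mul_of_nonneg_left h6 (by linarith : 0 ≤ 1 - t ω)
    linarith
  -- Where `ε = 2`, the vectors `x` and `y` themselves are already unit vectors at distance `2`.
  let E : Event Ω := ⟨{ω | ε ω < 2}, measurableSet_lt (measurable_coe ε) measurable_const⟩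
  let v₁ : S := ind P E • u + (1 - ind P E) • x
  let v₂ : S := ind P E • (u - d) + (1 - ind P E) • y
  have hv_sub := N.concat_ae E d (x - y)
  rw [show ind P E • d + (1 - ind P E) • (x - y) = v₁ - v₂ by simp only [v₁, v₂]; module] at hv_sub
  have hv_add := N.concat_ae E (u + (u - d)) (x + y)
  rw [show ind P E • (u + (u - d)) + (1 - ind P E) • (x + y) = v₁ + v₂ by
    simp only [v₁, v₂]; module] at hv_add
  have hv : ∀ᵐ ω ∂P, ω ∈ (D : Set Ω) → N v₁ ω = 1 ∧ N v₂ ω = 1 ∧ N (v₁ - v₂) ω = ε ω ∧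
      N (x + y) ω ≤ N (v₁ + v₂) ω := by
    filter_upwards [hv_sub, hv_add, N.concat_ae E u x, N.concat_ae E (u - d) y, hu, hplus, hminus,
      hd, hε, hxy', hx, hy, N.sub_ae x y]
      with ω k1 k2 k3 k4 k5 k6 k7 k8 k9 k10 k11 k12 k13 hω
    obtain ⟨k14, k15⟩ := k9 hω
    have k16 := k10 hω
    by_cases hωE : ω ∈ (E : Set Ω)
    · rw [k1.1 hωE, k2.1 hωE, k3.1 hωE, k4.1 hωE]
      obtain ⟨h1, h2, h3⟩ := k5 hω (by rw [k8 hω]; exact hωE)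
      exact ⟨h1, h2, k8 hω, h3 (k6 hω) (k7 hω)⟩
    · rw [k1.2 hωE, k2.2 hωE, k3.2 hωE, k4.2 hωE]
      have h1 : 2 ≤ ε ω := not_lt.1 hωE
      exact ⟨by linarith, by linarith, by linarith, le_rfl⟩
  have hi_sub := N.ind_smul_ae D (v₁ - v₂)
  have hi_add := N.ind_smul_ae D (v₁ + v₂)
  rw [smul_sub] at hi_sub
  rw [smul_add] at hi_add
  refine ⟨_, ⟨ind P D • v₁, N.mem_sphere_of_ae hD ?_, ind P D • v₂, N.mem_sphere_of_ae hD ?_,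
    ?_, ?_, rfl⟩, ?_⟩
  · filter_upwards [hv] with ω h1 hω using (h1 hω).1
  · filter_upwards [hv] with ω h1 hω using (h1 hω).2.1
  · refine incl_iff_ae.2 ?_
    filter_upwards [hv, hε, N.ind_smul_ae D v₁, N.ind_smul_ae D v₂, hi_sub]
      with ω h1 h2 h3 h4 h5 hω
    change (0 < N (ind P D • v₁) ω ∧ 0 < N (ind P D • v₂) ω) ∧
      0 < N (ind P D • v₁ - ind P D • v₂) ω
    obtain ⟨h6, h7, h8, -⟩ := h1 hω
    rw [h3.1 hω, h4.1 hω, h5.1 hω, h6, h7, h8]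
    exact ⟨⟨one_pos, one_pos⟩, (h2 hω).1⟩
  · refine AEEqFun.ext ?_
    filter_upwards [hv, hi_sub, coe_mul (ind P D) (N (ind P D • v₁ - ind P D • v₂)),
      coe_mul ε (ind P D), ind_ae (P := P) D] with ω h1 h2 h3 h4 h5
    rw [h3, h4]
    by_cases hω : ω ∈ (D : Set Ω)
    · rw [h5.1 hω, h2.1 hω, (h1 hω).2.2.1, mul_comm]
    · rw [h5.2 hω, zero_mul, mul_zero]
  · refine le_iff_ae.2 ?_
    filter_upwards [hv, hi_add, N.norm_half_ae (ind P D • v₁ + ind P D • v₂),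
      N.norm_half_ae (x + y),
      coe_sub (ind P D) (ind P D * N ((2⁻¹ : ℝ) • (ind P D • v₁ + ind P D • v₂))),
      coe_mul (ind P D) (N ((2⁻¹ : ℝ) • (ind P D • v₁ + ind P D • v₂))),
      coe_sub (ind P D) (ind P D * N ((2⁻¹ : ℝ) • (x + y))),
      coe_mul (ind P D) (N ((2⁻¹ : ℝ) • (x + y))), ind_ae (P := P) D]
      with ω h1 h2 h3 h4 h5 h6 h7 h8 h9
    rw [h5, h6, h7, h8, h3, h4]
    by_cases hω : ω ∈ (D : Set Ω)
    · rw [h9.1 hω, h2.1 hω]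
      linarith [(h1 hω).2.2.2]
    · rw [h9.2 hω, zero_mul, zero_mul]

end Modulus

end L0Norm

end RandomConvexity

open MeasureTheory RandomConvexity in
theorem theorem1p2 {Ω : Type*} [MeasurableSpace Ω] (P : Measure Ω) [IsProbabilityMeasure P]
    (S : Type*) [AddCommGroup S] [Module ℝ S] [Module (Ω →ₘ[P] ℝ) S]
    [IsScalarTower ℝ (Ω →ₘ[P] ℝ) S]
    (N : L0Norm P S) (hS : N.IsComplete) (hG : 0 < P (N.G : Set Ω))
    (D : Event Ω) (hDG : Incl P D N.G) (hD : 0 < P (D : Set Ω))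
    (ε : Ω →ₘ[P] ℝ) (hε : 0 ≤ ε) (hεD : ∀ᵐ ω ∂P, ω ∈ (D : Set Ω) → 0 < ε ω ∧ ε ω ≤ 2) :
    IsGLB (N.deltaSet D ε) (N.delta D ε) ∧
    IsGLB (N.deltaSet₁ D ε) (N.delta₁ D ε) ∧
    IsGLB (N.deltaSet₂ D ε) (N.delta₂ D ε) ∧
    N.delta D ε = N.delta₁ D ε ∧ N.delta₁ D ε = N.delta₂ D ε := by
  obtain ⟨x₀, y₀, hxy⟩ := hS.exists_indep hDG
  have hcof : ∀ ζ ∈ N.deltaSet₂ D ε, ∃ ζ' ∈ N.deltaSet₁ D ε, ζ' ≤ ζ := fun ζ hζ =>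
    N.exists_mem_deltaSet₁_le hxy hD hεD hζ
  have hlb₂ : lowerBounds (N.deltaSet₁ D ε) = lowerBounds (N.deltaSet₂ D ε) := by
    refine Set.Subset.antisymm (fun b hb ζ hζ => ?_)
      (lowerBounds_mono_set (N.deltaSet₁_subset.trans N.deltaSet_subset))
    obtain ⟨ζ', hζ', hle⟩ := hcof ζ hζ
    exact (hb hζ').trans hle
  have hlb : lowerBounds (N.deltaSet₁ D ε) = lowerBounds (N.deltaSet D ε) :=
    Set.Subset.antisymm (hlb₂ ▸ lowerBounds_mono_set N.deltaSet_subset)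
      (lowerBounds_mono_set N.deltaSet₁_subset)
  obtain ⟨g, hg₂⟩ := exists_isGLB (N.deltaSet₂_nonempty hxy hεD)
    ⟨0, N.zero_mem_lowerBounds_deltaSet₂⟩
  have hg₁ : IsGLB (N.deltaSet₁ D ε) g := by rwa [IsGLB, hlb₂]
  have hg : IsGLB (N.deltaSet D ε) g := by rwa [IsGLB, ← hlb]
  have h := isGLB_bigwedge ⟨g, hg⟩
  have h₁ := isGLB_bigwedge ⟨g, hg₁⟩
  have h₂ := isGLB_bigwedge ⟨g, hg₂⟩
  exact ⟨h, h₁, h₂, (h.unique hg).trans (hg₁.unique h₁), (h₁.unique hg₁).trans (hg₂.unique h₂)⟩
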